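/- Let $m,n\ge 0$ be integers, let $\|\cdot\|$ be a norm on $\mathbb{R}^m$ with dual norm $\|s\|_*=\sup\{s^\top y:\|y\|\le 1\}$, and let $e=(1,\dots,1)^\top\in\mathbb{R}^m$. Write $\mathbb{R}^m_{++}$ for the set of vectors with positive entries. Let $a^0\in\mathbb{R}^m_{++}$, $A^0=\operatorname{diag}(a^0)$, $\tau,\delta\ge 0$ and $A,V\in\mathbb{R}^{m\times m}$. Put $$Z^0=\bigl\{(y,z)\in\mathbb{R}^m\times\mathbb{R}^m_{++} : z_i-\ln z_i-1\le y_i\ (i=1,\dots,m),\ \|Ay\|\le\tau,\ \|V(z-e)\|\le\delta\bigr\},$$ $$\Omega=\Omega(a^0,\tau,\delta,A,V)=\{A^0z : (y,z)\in Z^0 \text{ for some } y\in\mathbb{R}^m\},$$ and assume that $Z^0$ is compact (this holds, for example, whenever $A$ is non-singular). Let $S\subseteq\mathbb{R}^n$, and let $f_0:\mathbb{R}^m\times\mathbb{R}^n\to(-\infty,+\infty]$ be such that, for every $x\in\mathbb{R}^n$, the function $f_0(\cdot,x)$ is convex and $a^0\in\operatorname{ri}\operatorname{dom}f_0(\cdot,x)$,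 where $\operatorname{dom}f_0(\cdot,x)=\{a: f_0(a,x)<+\infty\}$. Let $f_0^*(v,x)=\sup_{a\in\operatorname{dom}f_0(\cdot,x)}\{v^\top a-f_0(a,x)\}$. Consider the robust problem $$(\mathrm{RC}_{\mathrm{P\,obj}})\qquad \sup_{x\in S}\ \varphi(x),\qquad \varphi(x)=\inf_{a\in\Omega}f_0(a,x),$$ and the problem $$(\mathrm{DRC}_{\mathrm{P\,obj}})\qquad \sup_{x,u,v,w,s^1,s^2}\ \psi(x,u,v,w,s^1,s^2)\quad\text{subject to}\quad x\in S,\ (u,v,w,s^1,s^2)\in D,$$ where $$\psi=-(a^0)^\top v+\sum_{k=1}^m\Bigl\{u_k\ln\Bigl(1-\frac{w_k}{u_k}\Bigr)+w_k\Bigr\}-\tau\|s^1\|_*-\delta\|s^2\|_*-f_0^*(-v,x)$$ and $D$ is the set of all $(u,v,w,s^1,s^2)\in(\mathbb{R}^m)^5$ with $$A^\top s^1=u,\quad w+V^\top s^2=A^0v,\quad u\in\mathbb{R}^m_{++},\quad u-w\in\mathbb{R}^m_{++}.$$ Then the two problems are equivalent in the following sense. 1. For every $x\in\mathbb{R}^n$,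 $\varphi(x)=\sup_{d\in D}\psi(x,d)$. 2. The two problems have the same optimal value (in $[-\infty,+\infty]$). 3. A point $x$ is an optimal solution of $(\mathrm{RC}_{\mathrm{P\,obj}})$ if and only if $x\in S$ and $\sup_{d\in D}\psi(x,d)$ equals the optimal value of $(\mathrm{DRC}_{\mathrm{P\,obj}})$. 4. A point $(x,d)$ is an optimal solution of $(\mathrm{DRC}_{\mathrm{P\,obj}})$ if and only if $x$ is an optimal solution of $(\mathrm{RC}_{\mathrm{P\,obj}})$, $d\in D$ and $\psi(x,d)=\varphi(x)$. 5. For every $x$ for which $f_0(\cdot,x)$ is finite on all of $\mathbb{R}^m$, the infimum defining $\varphi(x)$ is attained. -/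

import Mathlib

open scoped Matrix

noncomputable section

namespace RobustPos

/-- Effective domain of an extended-real-valued function on `ℝ^m`. -/
def effDom {m : ℕ} (g : (Fin m → ℝ) → EReal) : Set (Fin m → ℝ) :=
  {a | g a < ⊤}

/-- Convexity of an extended-real-valued function: its epigraph is a convex set. -/
def IsConvexFun {m : ℕ} (g : (Fin m → ℝ) → EReal) : Prop :=
  Convex ℝ {p : (Fin m → ℝ) × ℝ | g p.1 ≤ (p.2 : EReal)}

/-- Convex conjugate `g^*(v) = sup_{a ∈ dom g} (vᵀ a - g a)`. -/
def conjugate {m : ℕ} (g : (Fin m → ℝ) → EReal) (v : Fin m → ℝ) : EReal :=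
  ⨆ a ∈ effDom g, ((v ⬝ᵥ a : ℝ) : EReal) - g a

/-- Dual norm `‖s‖_* = sup {sᵀ y : ‖y‖ ≤ 1}` of the norm `N`. -/
def dualNorm {m : ℕ} (N : Seminorm ℝ (Fin m → ℝ)) (s : Fin m → ℝ) : ℝ :=
  sSup ((fun y => s ⬝ᵥ y) '' {y | N y ≤ 1})

/-- The set `Z⁰` of pairs `(y, z)` with `z > 0`, `z_i - ln z_i - 1 ≤ y_i`, `‖A y‖ ≤ τ` and
`‖V (z - e)‖ ≤ δ`. -/
def shapeSet {m : ℕ} (N : Seminorm ℝ (Fin m → ℝ)) (τ δ : ℝ) (A V : Matrix (Fin m) (Fin m) ℝ) :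
    Set ((Fin m → ℝ) × (Fin m → ℝ)) :=
  {p | (∀ i, 0 < p.2 i) ∧ (∀ i, p.2 i - Real.log (p.2 i) - 1 ≤ p.1 i) ∧
    N (A *ᵥ p.1) ≤ τ ∧ N (V *ᵥ (p.2 - 1)) ≤ δ}

/-- The uncertainty set `Ω(a⁰, τ, δ, A, V)`: all `a = diag(a⁰) z` with `(y, z) ∈ Z⁰`. -/
def uncertaintySet {m : ℕ} (N : Seminorm ℝ (Fin m → ℝ)) (a0 : Fin m → ℝ) (τ δ : ℝ)
    (A V : Matrix (Fin m) (Fin m) ℝ) : Set (Fin m → ℝ) :=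
  {a | ∃ y z, (y, z) ∈ shapeSet N τ δ A V ∧ a = Matrix.diagonal a0 *ᵥ z}

/-- Objective of the robust problem at `x`: the infimum of `f₀(a, x)` over `a ∈ Ω`. -/
def worstCase {m n : ℕ} (f0 : (Fin m → ℝ) → (Fin n → ℝ) → EReal) (Ω : Set (Fin m → ℝ))
    (x : Fin n → ℝ) : EReal :=
  ⨅ a ∈ Ω, f0 a x

/-- The auxiliary variables of the dual problem. -/
structure DualVars (m : ℕ) where
  u : Fin m → ℝ
  v : Fin m → ℝ
  w : Fin m → ℝ
  s1 : Fin m → ℝ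
  s2 : Fin m → ℝ

/-- The constraints of the dual problem on the auxiliary variables. -/
def dualFeasible {m : ℕ} (a0 : Fin m → ℝ) (A V : Matrix (Fin m) (Fin m) ℝ) :
    Set (DualVars m) :=
  {d | Aᵀ *ᵥ d.s1 = d.u ∧ d.w + Vᵀ *ᵥ d.s2 = Matrix.diagonal a0 *ᵥ d.v ∧
    (∀ k, 0 < d.u k) ∧ (∀ k, 0 < (d.u - d.w) k)}

/-- The objective of the dual problem. -/
def dualObjective {m n : ℕ} (f0 : (Fin m → ℝ) → (Fin n → ℝ) → EReal)
    (N : Seminorm ℝ (Fin m → ℝ)) (a0 : Fin m → ℝ) (τ δ : ℝ)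
    (x : Fin n → ℝ) (d : DualVars m) : EReal :=
  ((-(a0 ⬝ᵥ d.v) + ∑ k, (d.u k * Real.log (1 - d.w k / d.u k) + d.w k)
      - τ * dualNorm N d.s1 - δ * dualNorm N d.s2 : ℝ) : EReal)
    - conjugate (fun a => f0 a x) (-d.v)

/-- `p` is an optimal solution of the problem of maximizing `F` over `C`. -/
def IsOptimal {α : Type*} (F : α → EReal) (C : Set α) (p : α) : Prop :=
  p ∈ C ∧ ∀ q ∈ C, F q ≤ F p

end RobustPos

end

open RobustPos

/-!
Fix `x` and let `c` be a real number below the infimum of `g = f₀(·, x)` over `Ω`. Because `Ω` is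
compact and meets the relative interior of `dom g`, the set `Ω × {c}` can be strictly separated
from the closure of the epigraph of `g` by a nonvertical hyperplane; its slope is the variable `v`.
What remains is to bound the support function of `Ω`, that is, to minimise a linear cost over the
pairs `(y, z)` satisfying the logarithmic constraint with `‖A y‖ ≤ τ` and `‖V (z - e)‖ ≤ δ`.
Compactness of `Z⁰` leaves no nonzero `y ≥ 0` in the kernel of `A`, so by Gordan's alternative
`Aᵀ s > 0` for some `s`. This vector makes the image of the logarithmic epigraph under
`(y, h) ↦ (A y, V h)` closed, whence Lagrange multipliers `s¹, s²` exist without any constraint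
qualification, and it supplies the direction in which `s¹` is perturbed to make the multipliers
strictly feasible. Finally, minimising `uᵀ y - wᵀ h` over the logarithmic epigraph separates into
scalar problems with value `u ln (1 - w / u) + w`.
-/

namespace RobustPos

section Separation

variable {E F : Type*} [AddCommGroup E] [Module ℝ E]
  [AddCommGroup F] [Module ℝ F] [TopologicalSpace F] [IsTopologicalAddGroup F]
  [ContinuousSMul ℝ F] [LocallyConvexSpace ℝ F]

theorem exists_nonvertical_separation {C : Set (F × ℝ)} {B : Set F} {c : ℝ}
    (hC : Convex ℝ C) (hC_closed : IsClosed C) (hB : Convex ℝ B) (hB_compact : IsCompact B)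
    (hdisj : ∀ b ∈ B, (b, c) ∉ C) (habove : ∃ b ∈ B, ∃ r > c, (b, r) ∈ C) :
    ∃ (ℓ : F →L[ℝ] ℝ) (κ : ℝ), (∀ b ∈ B, ℓ b + c < κ) ∧ ∀ p ∈ C, κ < ℓ p.1 + p.2 := by
  have hdisj' : Disjoint (B ×ˢ {c}) C := by
    rw [Set.disjoint_left]
    rintro ⟨b, _⟩ ⟨hb, rfl⟩
    exact hdisj b hb
  obtain ⟨f, α, β, hfB, hαβ, hfC⟩ := geometric_hahn_banach_compact_closed
    (hB.prod (convex_singleton c)) (hB_compact.prod isCompact_singleton) hC hC_closed hdisj'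
  set μ : ℝ := f (0, 1)
  have hf : ∀ y r, f (y, r) = f (y, 0) + μ * r := fun y r => by
    rw [mul_comm, ← smul_eq_mul, ← map_smul, ← map_add]
    simp
  have hμ : 0 < μ := by
    obtain ⟨b, hb, r, hr, hbr⟩ := habove
    have hlt : f (b, c) < f (b, r) := ((hfB (b, c) ⟨hb, rfl⟩).trans hαβ).trans (hfC _ hbr)
    rw [hf, hf b r] at hlt
    exact pos_of_mul_pos_left (by linarith : 0 < μ * (r - c)) (sub_pos.2 hr).le
  have hscale : ∀ y r, (μ⁻¹ • f.comp (.inl ℝ F ℝ)) y + r = μ⁻¹ * f (y, r) := fun y r => by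
    rw [hf, mul_add, inv_mul_cancel_left₀ hμ.ne']
    rfl
  refine ⟨μ⁻¹ • f.comp (.inl ℝ F ℝ), μ⁻¹ * β, fun b hb => ?_, fun p hp => ?_⟩
  · rw [hscale]
    gcongr
    exact (hfB (b, c) ⟨hb, rfl⟩).trans hαβ
  · rw [hscale]
    gcongr
    exact hfC _ hp

theorem exists_lagrange_multiplier {K : Set E} {q : E → ℝ} {L : E →ₗ[ℝ] F} {B : Set F} {c : ℝ}
    (hq : ConvexOn ℝ K q)
    (hclosed : IsClosed (Prod.map L id '' {p : E × ℝ | p.1 ∈ K ∧ q p.1 ≤ p.2}))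
    (hB : Convex ℝ B) (hB_compact : IsCompact B) (hfeas : ∃ x ∈ K, L x ∈ B)
    (hc : ∀ x ∈ K, L x ∈ B → c < q x) :
    ∃ ℓ : F →L[ℝ] ℝ, ∀ x ∈ K, ∀ b ∈ B, ℓ b + c < ℓ (L x) + q x := by
  have hconv : Convex ℝ (Prod.map L id '' {p : E × ℝ | p.1 ∈ K ∧ q p.1 ≤ p.2}) :=
    hq.convex_epigraph.linear_image (L.prodMap LinearMap.id)
  obtain ⟨ℓ, κ, hℓB, hℓC⟩ := exists_nonvertical_separation hconv hclosed hB hB_compact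
    (c := c)
    (by rintro b hb ⟨⟨x, r⟩, ⟨hx, hr⟩, hxb⟩
        obtain ⟨rfl, rfl⟩ := Prod.ext_iff.1 hxb
        exact (hc x hx hb).not_ge hr)
    (by obtain ⟨x, hx, hxB⟩ := hfeas
        exact ⟨L x, hxB, q x, hc x hx hxB, (x, q x), ⟨hx, le_rfl⟩, rfl⟩)
  exact ⟨ℓ, fun x hx b hb =>
    (hℓB b hb).trans (hℓC (L x, q x) ⟨(x, q x), ⟨hx, le_rfl⟩, rfl⟩)⟩

end Separation

theorem isClosed_image_of_isCompact_inter_preimage {X Y : Type*} [TopologicalSpace X]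
    [TopologicalSpace Y] [T2Space Y] [WeaklyLocallyCompactSpace Y] {f : X → Y} {K : Set X}
    (hf : Continuous f) (hK : IsClosed K)
    (hcompact : ∀ Q, IsCompact Q → IsCompact (K ∩ f ⁻¹' Q)) : IsClosed (f '' K) := by
  have hproper : IsProperMap (Set.domRestrict K f) := by
    refine isProperMap_iff_isCompact_preimage.2 ⟨hf.comp continuous_subtype_val, fun Q hQ => ?_⟩
    rw [Set.domRestrict_eq, Set.preimage_comp, ← Subtype.preimage_coe_self_inter]
    exact hK.isClosedEmbedding_subtypeVal.isCompact_preimage (hcompact Q hQ)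
  simpa only [Set.range_domRestrict] using hproper.isClosedMap.isClosed_range

section ConvexFunction

variable {E : Type*} [NormedAddCommGroup E] [NormedSpace ℝ E] [FiniteDimensional ℝ E]
  {s : Set E} {f : E → ℝ}

theorem mem_interior_epigraph {x : E} {M : ℝ} (hf : ConvexOn ℝ s f) (hx : x ∈ interior s)
    (hM : f x < M) : (x, M) ∈ interior {p : E × ℝ | p.1 ∈ s ∧ f p.1 ≤ p.2} := by
  have hcont : ContinuousAt f x :=
    hf.continuousOn_interior.continuousAt (isOpen_interior.mem_nhds hx)
  rw [mem_interior_iff_mem_nhds]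
  filter_upwards [continuousAt_fst.eventually (mem_interior_iff_mem_nhds.1 hx),
    (hcont.comp (x := (x, M)) continuousAt_fst).eventually_lt continuousAt_snd hM]
    with p hps hlt
  exact ⟨hps, hlt.le⟩

theorem segment_mem_epigraph_of_mem_interior {x₀ x : E} {M r t : ℝ} (hf : ConvexOn ℝ s f)
    (hx₀ : x₀ ∈ interior s) (hM : f x₀ < M)
    (hx : (x, r) ∈ closure {p : E × ℝ | p.1 ∈ s ∧ f p.1 ≤ p.2}) (ht : t ∈ Set.Ioo 0 1) :
    (1 - t) • (x₀, M) + t • (x, r) ∈ {p : E × ℝ | p.1 ∈ s ∧ f p.1 ≤ p.2} :=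
  interior_subset <| hf.convex_epigraph.combo_interior_closure_mem_interior
    (mem_interior_epigraph hf hx₀ hM) hx (sub_pos.2 ht.2) ht.1.le (sub_add_cancel 1 t)

theorem exists_affineIsometry_mem_interior_preimage {E : Type*} [NormedAddCommGroup E]
    [NormedSpace ℝ E] {s : Set E} {x₀ : E} (hx₀ : x₀ ∈ intrinsicInterior ℝ s) :
    ∃ ι : (affineSpan ℝ s).direction →ᵃⁱ[ℝ] E,
      ι 0 = x₀ ∧ Set.range ι = affineSpan ℝ s ∧ 0 ∈ interior (ι ⁻¹' s) := by
  obtain ⟨y₀, hy₀, rfl⟩ := mem_intrinsicInterior.1 hx₀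
  have : Nonempty (affineSpan ℝ s) := ⟨y₀⟩
  let shift := AffineIsometryEquiv.vaddConst ℝ y₀
  have hshift : shift 0 = y₀ := by simp [shift]
  refine ⟨(affineSpan ℝ s).subtypeₐᵢ.comp shift.toAffineIsometry, congrArg Subtype.val hshift,
    ?_, ?_⟩
  · exact (shift.surjective.range_comp Subtype.val).trans Subtype.range_coe
  · have hmem : (0 : (affineSpan ℝ s).direction) ∈ shift ⁻¹' interior (Subtype.val ⁻¹' s) := by
      rwa [Set.mem_preimage, hshift]
    exact preimage_interior_subset_interior_preimage shift.continuous hmem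

theorem segment_mem_epigraph_of_mem_intrinsicInterior {x₀ x : E} {M r t : ℝ}
    (hf : ConvexOn ℝ s f) (hx₀ : x₀ ∈ intrinsicInterior ℝ s) (hM : f x₀ < M)
    (hx : (x, r) ∈ closure {p : E × ℝ | p.1 ∈ s ∧ f p.1 ≤ p.2}) (ht : t ∈ Set.Ioo 0 1) :
    (1 - t) • (x₀, M) + t • (x, r) ∈ {p : E × ℝ | p.1 ∈ s ∧ f p.1 ≤ p.2} := by
  obtain ⟨ι, rfl, hrange, hinterior⟩ := exists_affineIsometry_mem_interior_preimage hx₀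
  have hs_range : s ⊆ Set.range ι := hrange ▸ subset_affineSpan ℝ s
  have hx_range : x ∈ Set.range ι := by
    have hclosed : IsClosed (Set.range ι) :=
      hrange ▸ AffineSubspace.closed_of_finiteDimensional _
    exact closure_minimal (t := Prod.fst ⁻¹' Set.range ι) (fun _ hp => hs_range hp.1)
      (hclosed.preimage continuous_fst) hx
  obtain ⟨w, rfl⟩ := hx_range
  have hw : (w, r) ∈ closure {p | p.1 ∈ ι ⁻¹' s ∧ (f ∘ ι) p.1 ≤ p.2} := by
    have hinducing : Topology.IsInducing (Prod.map ι (id : ℝ → ℝ)) :=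
      ι.isometry.isEmbedding.isInducing.prodMap .id
    rw [hinducing.closure_eq_preimage_closure_image]
    refine closure_mono ?_ hx
    rintro ⟨y, q⟩ ⟨hy, hq⟩
    obtain ⟨v, rfl⟩ := hs_range hy
    exact ⟨(v, q), ⟨hy, hq⟩, rfl⟩
  have hcombo := segment_mem_epigraph_of_mem_interior (hf.comp_affineMap ι.toAffineMap)
    hinterior hM hw ht
  have hmap : ι ((1 - t) • 0 + t • w) = (1 - t) • ι 0 + t • ι w :=
    Convex.combo_affine_apply (f := ι.toAffineMap) (sub_add_cancel 1 t)
  change (1 - t) • ι 0 + t • ι w ∈ s ∧ f ((1 - t) • ι 0 + t • ι w) ≤ (1 - t) • M + t • r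
  rwa [← hmap]

theorem le_of_mem_closure_epigraph {Ω : Set E} {x₀ x : E} {c r : ℝ} (hf : ConvexOn ℝ s f)
    (hΩ : Convex ℝ Ω) (hx₀ : x₀ ∈ intrinsicInterior ℝ s) (hx₀Ω : x₀ ∈ Ω)
    (hc : ∀ y ∈ Ω, y ∈ s → c ≤ f y) (hxΩ : x ∈ Ω)
    (hx : (x, r) ∈ closure {p : E × ℝ | p.1 ∈ s ∧ f p.1 ≤ p.2}) : c ≤ r := by
  have hcombo : ∀ t ∈ Set.Ioo (0 : ℝ) 1, c ≤ (1 - t) * (f x₀ + 1) + t * r := fun t ht => by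
    obtain ⟨hs, hle⟩ := segment_mem_epigraph_of_mem_intrinsicInterior hf hx₀
      (lt_add_one (f x₀)) hx ht
    have hmem : (1 - t) • x₀ + t • x ∈ Ω :=
      hΩ hx₀Ω hxΩ (sub_pos.2 ht.2).le ht.1.le (sub_add_cancel 1 t)
    exact (hc _ hmem hs).trans hle
  have hlim : Filter.Tendsto (fun t : ℝ => (1 - t) * (f x₀ + 1) + t * r)
      (nhdsWithin 1 (Set.Iio 1)) (nhds ((1 - 1) * (f x₀ + 1) + 1 * r)) :=
    (Continuous.tendsto (by fun_prop) 1).mono_left nhdsWithin_le_nhds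
  rw [sub_self, zero_mul, one_mul, zero_add] at hlim
  refine ge_of_tendsto hlim ?_
  filter_upwards [Ioo_mem_nhdsLT zero_lt_one] using hcombo

theorem exists_affine_minorant {Ω : Set E} {x₀ : E} {c c' : ℝ} (hf : ConvexOn ℝ s f)
    (hΩ : Convex ℝ Ω) (hΩ_compact : IsCompact Ω) (hx₀ : x₀ ∈ intrinsicInterior ℝ s)
    (hx₀Ω : x₀ ∈ Ω) (hcc' : c < c') (hc' : ∀ y ∈ Ω, y ∈ s → c' ≤ f y) :
    ∃ (ℓ : E →L[ℝ] ℝ) (κ : ℝ), (∀ y ∈ Ω, ℓ y + c < κ) ∧ ∀ y ∈ s, κ < ℓ y + f y := by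
  have hx₀s : x₀ ∈ s := intrinsicInterior_subset hx₀
  obtain ⟨ℓ, κ, hℓΩ, hℓs⟩ := exists_nonvertical_separation
    hf.convex_epigraph.closure isClosed_closure hΩ hΩ_compact
    (fun y hy hmem => hcc'.not_ge (le_of_mem_closure_epigraph hf hΩ hx₀ hx₀Ω hc' hy hmem))
    ⟨x₀, hx₀Ω, f x₀, hcc'.trans_le (hc' x₀ hx₀Ω hx₀s), subset_closure ⟨hx₀s, le_rfl⟩⟩
  exact ⟨ℓ, κ, hℓΩ, fun y hy => hℓs (y, f y) (subset_closure ⟨hy, le_rfl⟩)⟩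

end ConvexFunction

section DualNorm

theorem convex_setOf_seminorm_le {E : Type*} [AddCommGroup E] [Module ℝ E] (N : Seminorm ℝ E)
    (r : ℝ) : Convex ℝ {y | N y ≤ r} :=
  N.closedBall_zero_eq ▸ N.convex_closedBall 0 r

theorem exists_pos_mul_norm_le {E : Type*} [NormedAddCommGroup E] [NormedSpace ℝ E]
    [FiniteDimensional ℝ E] {N : Seminorm ℝ E} (hN : ∀ y, N y = 0 → y = 0) :
    ∃ c > 0, ∀ y, c * ‖y‖ ≤ N y := by
  rcases subsingleton_or_nontrivial E with h | h
  · exact ⟨1, one_pos, fun y => by simp [Subsingleton.elim y 0]⟩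
  have hcont : Continuous N := N.convexOn.locallyLipschitz.continuous
  obtain ⟨y₀, hy₀, hmin⟩ := (isCompact_sphere (0 : E) 1).exists_isMinOn
    (NormedSpace.sphere_nonempty.2 zero_le_one) hcont.continuousOn
  have hpos : 0 < N y₀ := by
    refine (apply_nonneg N y₀).lt_of_ne' fun h0 => ?_
    simp [hN y₀ h0] at hy₀
  refine ⟨N y₀, hpos, fun y => ?_⟩
  rcases eq_or_ne y 0 with rfl | hy
  · simp
  have hmem : ‖y‖⁻¹ • y ∈ Metric.sphere (0 : E) 1 := by
    rw [mem_sphere_zero_iff_norm, norm_smul, norm_inv, norm_norm,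
      inv_mul_cancel₀ (norm_ne_zero_iff.2 hy)]
  have hle : N y₀ ≤ N (‖y‖⁻¹ • y) := hmin hmem
  rw [map_smul_eq_mul, norm_inv, norm_norm] at hle
  rwa [← le_inv_mul_iff₀' (norm_pos_iff.2 hy)]

theorem isCompact_setOf_seminorm_le {E : Type*} [NormedAddCommGroup E] [NormedSpace ℝ E]
    [FiniteDimensional ℝ E] {N : Seminorm ℝ E} (hN : ∀ y, N y = 0 → y = 0) (r : ℝ) :
    IsCompact {y | N y ≤ r} := by
  obtain ⟨c, hc, hle⟩ := exists_pos_mul_norm_le hN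
  refine Metric.isCompact_of_isClosed_isBounded
    (isClosed_le N.convexOn.locallyLipschitz.continuous continuous_const)
    (isBounded_iff_forall_norm_le.2 ⟨r / c, fun y hy => ?_⟩)
  rw [le_div_iff₀' hc]
  exact (hle y).trans hy

variable {m : ℕ} {N : Seminorm ℝ (Fin m → ℝ)}

theorem isGreatest_dualNorm (hN : ∀ y, N y = 0 → y = 0) (s : Fin m → ℝ) :
    IsGreatest ((fun y => s ⬝ᵥ y) '' {y | N y ≤ 1}) (dualNorm N s) :=
  ((isCompact_setOf_seminorm_le hN 1).image (by fun_prop)).isGreatest_sSup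
    ⟨_, 0, by simp, rfl⟩

theorem isGreatest_mul_dualNorm (hN : ∀ y, N y = 0 → y = 0) (s : Fin m → ℝ) {r : ℝ}
    (hr : 0 ≤ r) : IsGreatest ((fun y => s ⬝ᵥ y) '' {y | N y ≤ r}) (r * dualNorm N s) := by
  constructor
  · obtain ⟨y, hy, hsy⟩ := (isGreatest_dualNorm hN s).1
    refine ⟨r • y, ?_, ?_⟩
    · simpa [map_smul_eq_mul, abs_of_nonneg hr] using mul_le_of_le_one_right hr hy
    · simpa using congrArg (r * ·) hsy
  · rintro _ ⟨y, hy, rfl⟩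
    rcases hr.eq_or_lt with rfl | hr
    · simp [hN y (le_antisymm hy (apply_nonneg N y))]
    have hmem : N (r⁻¹ • y) ≤ 1 := by
      rw [map_smul_eq_mul, norm_inv, Real.norm_of_nonneg hr.le]
      exact inv_mul_le_one_of_le₀ hy hr.le
    have hle := (isGreatest_dualNorm hN s).2 ⟨_, hmem, rfl⟩
    simp only [dotProduct_smul, smul_eq_mul] at hle
    rwa [inv_mul_le_iff₀ hr] at hle

theorem dualNorm_add_smul_le (hN : ∀ y, N y = 0 → y = 0) (s t : Fin m → ℝ) {ε : ℝ}
    (hε : 0 ≤ ε) : dualNorm N (s + ε • t) ≤ dualNorm N s + ε * dualNorm N t := by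
  obtain ⟨y, hy, hsy⟩ := (isGreatest_dualNorm hN (s + ε • t)).1
  rw [← hsy]
  simp only [add_dotProduct, smul_dotProduct, smul_eq_mul]
  have hs := (isGreatest_dualNorm hN s).2 ⟨y, hy, rfl⟩
  have ht := (isGreatest_dualNorm hN t).2 ⟨y, hy, rfl⟩
  dsimp only at hs ht
  gcongr

end DualNorm

/-- The pairs `(y, h)` with `h i - log (1 + h i) ≤ y i` for every `i`: the shape constraint
of `Z⁰` in the variable `h = z - e`. The exponential form makes `-1 < h i` automatic and the
constraint visibly closed. -/
def logEpigraph (ι : Type*) : Set ((ι → ℝ) × (ι → ℝ)) :=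
  {q | ∀ i, Real.exp (q.2 i - q.1 i) ≤ 1 + q.2 i}

theorem exp_sub_le_one_add_iff {y h : ℝ} :
    Real.exp (h - y) ≤ 1 + h ↔ 0 < 1 + h ∧ h - Real.log (1 + h) ≤ y := by
  constructor
  · intro hexp
    have hpos : 0 < 1 + h := (Real.exp_pos _).trans_le hexp
    exact ⟨hpos, sub_le_comm.1 ((Real.le_log_iff_exp_le hpos).2 hexp)⟩
  · rintro ⟨hpos, hlog⟩
    exact (Real.le_log_iff_exp_le hpos).1 (sub_le_comm.1 hlog)

section LogEpigraph

variable {ι : Type*} {q : (ι → ℝ) × (ι → ℝ)}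

theorem isClosed_logEpigraph : IsClosed (logEpigraph ι) := by
  simp only [logEpigraph, Set.ofPred_forall]
  exact isClosed_iInter fun i => isClosed_le (by fun_prop) (by fun_prop)

theorem convex_logEpigraph : Convex ℝ (logEpigraph ι) := by
  intro p hp q hq a b ha hb hab i
  calc Real.exp ((a • p + b • q).2 i - (a • p + b • q).1 i)
      = Real.exp (a • (p.2 i - p.1 i) + b • (q.2 i - q.1 i)) := by
        congr 1
        simp only [Prod.snd_add, Prod.smul_snd, Prod.fst_add, Prod.smul_fst, Pi.add_apply,
          Pi.smul_apply, smul_eq_mul]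
        ring
    _ ≤ a • Real.exp (p.2 i - p.1 i) + b • Real.exp (q.2 i - q.1 i) :=
        convexOn_exp.2 trivial trivial ha hb hab
    _ ≤ a • (1 + p.2 i) + b • (1 + q.2 i) := by
        gcongr
        exacts [hp i, hq i]
    _ = 1 + (a • p + b • q).2 i := by
        simp only [Prod.snd_add, Prod.smul_snd, Pi.add_apply, Pi.smul_apply, smul_eq_mul]
        linear_combination hab

theorem zero_mem_logEpigraph : (0 : (ι → ℝ) × (ι → ℝ)) ∈ logEpigraph ι := fun i => by simp

theorem neg_one_le_snd_of_mem_logEpigraph (hq : q ∈ logEpigraph ι) (i : ι) : -1 ≤ q.2 i := by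
  linarith [hq i, Real.exp_pos (q.2 i - q.1 i)]

theorem fst_nonneg_of_mem_logEpigraph (hq : q ∈ logEpigraph ι) (i : ι) : 0 ≤ q.1 i := by
  linarith [hq i, Real.add_one_le_exp (q.2 i - q.1 i)]

theorem snd_le_of_mem_logEpigraph (hq : q ∈ logEpigraph ι) (i : ι) :
    q.2 i ≤ 2 * q.1 i + 1 := by
  linarith [hq i, Real.two_mul_le_exp (x := q.2 i - q.1 i)]

theorem add_mem_logEpigraph {d : (ι → ℝ) × (ι → ℝ)} (hq : q ∈ logEpigraph ι) (hd : 0 ≤ d.2)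
    (hd' : d.2 ≤ d.1) : q + d ∈ logEpigraph ι := fun i =>
  calc Real.exp ((q + d).2 i - (q + d).1 i) ≤ Real.exp (q.2 i - q.1 i) := by
        gcongr 1
        simp only [Prod.snd_add, Prod.fst_add, Pi.add_apply]
        linarith [hd' i]
    _ ≤ 1 + q.2 i := hq i
    _ ≤ 1 + (q + d).2 i := by
        gcongr 1
        exact le_add_of_nonneg_right (hd i)

variable [Fintype ι]

theorem isCompact_logEpigraph_inter {a : ι → ℝ} (ha : ∀ i, 0 < a i) (R : ℝ) :
    IsCompact {q ∈ logEpigraph ι | a ⬝ᵥ q.1 ≤ R} := by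
  have hclosed : IsClosed {q ∈ logEpigraph ι | a ⬝ᵥ q.1 ≤ R} :=
    isClosed_logEpigraph.inter
      (isClosed_le (f := fun q : (ι → ℝ) × (ι → ℝ) => a ⬝ᵥ q.1) (by fun_prop) continuous_const)
  refine (isCompact_Icc (a := (0 : ι → ℝ)) (b := fun i => R / a i)).prod
    (isCompact_Icc (a := (-1 : ι → ℝ)) (b := fun i => 2 * (R / a i) + 1))
    |>.of_isClosed_subset hclosed ?_
  rintro q ⟨hq, hR⟩
  have hnonneg := fst_nonneg_of_mem_logEpigraph hq
  have hfst : ∀ i, q.1 i ≤ R / a i := fun i => by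
    rw [le_div_iff₀' (ha i)]
    exact (Finset.single_le_sum (f := fun i => a i * q.1 i)
      (fun j _ => mul_nonneg (ha j).le (hnonneg j)) (Finset.mem_univ i)).trans hR
  have hsnd : ∀ i, q.2 i ≤ 2 * (R / a i) + 1 := fun i =>
    (snd_le_of_mem_logEpigraph hq i).trans (by linarith [hfst i])
  exact ⟨⟨hnonneg, hfst⟩, neg_one_le_snd_of_mem_logEpigraph hq, hsnd⟩

theorem nonneg_of_forall_mem_logEpigraph_le {u w : ι → ℝ} {B : ℝ}
    (hB : ∀ q ∈ logEpigraph ι, B ≤ u ⬝ᵥ q.1 - w ⬝ᵥ q.2) {d : (ι → ℝ) × (ι → ℝ)}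
    (hd : 0 ≤ d.2) (hd' : d.2 ≤ d.1) : 0 ≤ u ⬝ᵥ d.1 - w ⬝ᵥ d.2 := by
  by_contra! hneg
  obtain ⟨k, hk⟩ := Archimedean.arch (1 - B) (neg_pos.2 hneg)
  have hmem : 0 + (k : ℝ) • d ∈ logEpigraph ι := add_mem_logEpigraph zero_mem_logEpigraph
    (smul_nonneg k.cast_nonneg hd) (smul_le_smul_of_nonneg_left hd' k.cast_nonneg)
  have hle := hB _ hmem
  simp only [zero_add, Prod.smul_fst, Prod.smul_snd, dotProduct_smul, nsmul_eq_mul,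
    smul_eq_mul] at hle hk
  linarith

theorem nonneg_and_le_of_forall_mem_logEpigraph_le {u w : ι → ℝ} {B : ℝ}
    (hB : ∀ q ∈ logEpigraph ι, B ≤ u ⬝ᵥ q.1 - w ⬝ᵥ q.2) (i : ι) : 0 ≤ u i ∧ w i ≤ u i := by
  classical
  have hsingle : (0 : ι → ℝ) ≤ Pi.single i 1 := Pi.single_nonneg.2 zero_le_one
  constructor
  · simpa using nonneg_of_forall_mem_logEpigraph_le hB (d := (Pi.single i 1, 0)) le_rfl hsingle
  · simpa using nonneg_of_forall_mem_logEpigraph_le hB (d := (Pi.single i 1, Pi.single i 1))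
      hsingle le_rfl

theorem mul_log_add_le {u w y h : ℝ} (hu : 0 < u) (huw : 0 < u - w)
    (hyh : Real.exp (h - y) ≤ 1 + h) : u * Real.log (1 - w / u) + w ≤ u * y - w * h := by
  obtain ⟨hpos, hlog⟩ := exp_sub_le_one_add_iff.1 hyh
  have hquot : 0 < 1 - w / u := by
    rw [one_sub_div hu.ne']
    exact div_pos huw hu
  have hprod : Real.log (1 + h) + Real.log (1 - w / u) ≤ (1 + h) * (1 - w / u) - 1 := by
    rw [← Real.log_mul hpos.ne' hquot.ne']
    exact Real.log_le_sub_one_of_pos (mul_pos hpos hquot)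
  calc u * Real.log (1 - w / u) + w
      ≤ u * ((1 + h) * (1 - w / u) - 1 - Real.log (1 + h)) + w := by
        gcongr
        linarith
    _ = u * (h - Real.log (1 + h)) - w * h := by
        field_simp
        ring
    _ ≤ u * y - w * h := by gcongr

theorem isLeast_image_logEpigraph {u w : ι → ℝ} (hu : ∀ i, 0 < u i)
    (huw : ∀ i, 0 < u i - w i) :
    IsLeast ((fun q => u ⬝ᵥ q.1 - w ⬝ᵥ q.2) '' logEpigraph ι)
      (∑ i, (u i * Real.log (1 - w i / u i) + w i)) := by
  constructor
  · refine ⟨(fun i => w i / (u i - w i) + Real.log (1 - w i / u i), fun i => w i / (u i - w i)),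
      fun i => ?_, ?_⟩
    · have hquot : 0 < 1 - w i / u i := by
        rw [one_sub_div (hu i).ne']
        exact div_pos (huw i) (hu i)
      have hinv : 1 + w i / (u i - w i) = (1 - w i / u i)⁻¹ := by
        rw [one_sub_div (hu i).ne', inv_div, one_add_div (huw i).ne', sub_add_cancel]
      simp only [sub_add_cancel_left, Real.exp_neg, Real.exp_log hquot, hinv, le_refl]
    · simp only [dotProduct, ← Finset.sum_sub_distrib]
      refine Finset.sum_congr rfl fun i _ => ?_
      linear_combination div_mul_cancel₀ (w i) (huw i).ne'
  · rintro _ ⟨q, hq, rfl⟩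
    simp only [dotProduct, ← Finset.sum_sub_distrib]
    exact Finset.sum_le_sum fun i _ => mul_log_add_le (hu i) (huw i) (hq i)

end LogEpigraph

theorem exists_transpose_mulVec_pos {κ ι : Type*} [Fintype κ] [Fintype ι] {A : Matrix κ ι ℝ}
    (hA : ∀ y, 0 ≤ y → A *ᵥ y = 0 → y = 0) : ∃ s, ∀ i, 0 < (Aᵀ *ᵥ s) i := by
  classical
  have hcompact : IsCompact (A.mulVecLin '' stdSimplex ℝ ι) :=
    (isCompact_stdSimplex ℝ ι).image A.mulVecLin.continuous_of_finiteDimensional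
  have hzero : (0 : κ → ℝ) ∉ A.mulVecLin '' stdSimplex ℝ ι := by
    rintro ⟨y, ⟨hy, hsum⟩, hAy⟩
    simp [hA y hy hAy] at hsum
  obtain ⟨f, c, hc, hf⟩ := geometric_hahn_banach_point_closed
    ((convex_stdSimplex ℝ ι).linear_image A.mulVecLin) hcompact.isClosed hzero
  obtain ⟨s, hs⟩ := (dotProductEquiv ℝ κ).surjective f
  refine ⟨s, fun i => ?_⟩
  have hpos : 0 < f (A *ᵥ Pi.single i 1) :=
    (f.map_zero ▸ hc).trans (hf _ ⟨_, single_mem_stdSimplex ℝ i, rfl⟩)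
  have heq : s ⬝ᵥ (A *ᵥ Pi.single i 1) = f (A *ᵥ Pi.single i 1) := DFunLike.congr_fun hs _
  rwa [← heq, Matrix.dotProduct_mulVec, dotProduct_single_one, ← Matrix.mulVec_transpose] at hpos

theorem isClosed_image_epigraph_of_pos {ι κ₁ κ₂ : Type*} [Fintype ι] [Fintype κ₁]
    [Finite κ₂] {A : Matrix κ₁ ι ℝ} (V : Matrix κ₂ ι ℝ) {s : κ₁ → ℝ}
    (hs : ∀ i, 0 < (Aᵀ *ᵥ s) i)
    {cost : (ι → ℝ) × (ι → ℝ) → ℝ} (hcost : Continuous cost) :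
    IsClosed (Prod.map (A.mulVecLin.prodMap V.mulVecLin) id ''
      {x : ((ι → ℝ) × (ι → ℝ)) × ℝ | x.1 ∈ logEpigraph ι ∧ cost x.1 ≤ x.2}) := by
  have hmap : Continuous (Prod.map (A.mulVecLin.prodMap V.mulVecLin) (id : ℝ → ℝ)) :=
    (LinearMap.continuous_of_finiteDimensional _).prodMap continuous_id
  have hclosed : IsClosed {x : ((ι → ℝ) × (ι → ℝ)) × ℝ | x.1 ∈ logEpigraph ι ∧ cost x.1 ≤ x.2} :=
    (isClosed_logEpigraph.preimage continuous_fst).inter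
      (isClosed_le (hcost.comp continuous_fst) continuous_snd)
  refine isClosed_image_of_isCompact_inter_preimage hmap hclosed fun Q hQ => ?_
  obtain ⟨R, hR⟩ := (hQ.image (f := fun b => s ⬝ᵥ b.1.1) (by fun_prop)).bddAbove
  refine ((isCompact_logEpigraph_inter hs R).prod (hQ.image continuous_snd)).of_isClosed_subset
    (hclosed.inter (hQ.isClosed.preimage hmap)) ?_
  rintro x ⟨⟨hx, -⟩, hxQ⟩
  refine ⟨⟨hx, ?_⟩, _, hxQ, rfl⟩
  rw [Matrix.mulVec_transpose, ← Matrix.dotProduct_mulVec]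
  exact hR ⟨_, hxQ, rfl⟩

/-- The set `Z⁰` recentred at its nominal point `(0, e)`: the pairs `(y, z - e)` with
`(y, z) ∈ Z⁰`. -/
def deviationSet {m : ℕ} (N : Seminorm ℝ (Fin m → ℝ)) (τ δ : ℝ)
    (A V : Matrix (Fin m) (Fin m) ℝ) : Set ((Fin m → ℝ) × (Fin m → ℝ)) :=
  {q ∈ logEpigraph (Fin m) | N (A *ᵥ q.1) ≤ τ ∧ N (V *ᵥ q.2) ≤ δ}

section UncertaintySet

variable {m : ℕ} {N : Seminorm ℝ (Fin m → ℝ)} {a0 : Fin m → ℝ} {τ δ : ℝ}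
  {A V : Matrix (Fin m) (Fin m) ℝ}

theorem mem_shapeSet_iff_sub_mem_deviationSet {p : (Fin m → ℝ) × (Fin m → ℝ)} :
    p ∈ shapeSet N τ δ A V ↔ p - (0, 1) ∈ deviationSet N τ δ A V := by
  simp only [shapeSet, deviationSet, logEpigraph, Set.mem_ofPred_eq, exp_sub_le_one_add_iff,
    forall_and, and_assoc, Prod.fst_sub, Prod.snd_sub, Pi.sub_apply, Pi.zero_apply, Pi.one_apply,
    sub_zero, add_sub_cancel, sub_right_comm]

theorem isCompact_deviationSet_iff :
    IsCompact (deviationSet N τ δ A V) ↔ IsCompact (shapeSet N τ δ A V) := by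
  rw [← (Homeomorph.subRight ((0 : Fin m → ℝ), (1 : Fin m → ℝ))).isCompact_preimage]
  exact iff_of_eq (congrArg IsCompact (Set.ext fun _ => mem_shapeSet_iff_sub_mem_deviationSet.symm))

theorem zero_mem_deviationSet (hτ : 0 ≤ τ) (hδ : 0 ≤ δ) : 0 ∈ deviationSet N τ δ A V :=
  ⟨zero_mem_logEpigraph, by simpa, by simpa⟩

theorem convex_deviationSet : Convex ℝ (deviationSet N τ δ A V) := by
  exact convex_logEpigraph.inter
    (((convex_setOf_seminorm_le N τ).linear_preimage (A.mulVecLin ∘ₗ .fst ℝ _ _)).inter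
      ((convex_setOf_seminorm_le N δ).linear_preimage (V.mulVecLin ∘ₗ .snd ℝ _ _)))

theorem uncertaintySet_eq_image : uncertaintySet N a0 τ δ A V =
    (fun q => a0 + Matrix.diagonal a0 *ᵥ q.2) '' deviationSet N τ δ A V := by
  have hdiag : ∀ z, Matrix.diagonal a0 *ᵥ z = a0 + Matrix.diagonal a0 *ᵥ (z - 1) := fun z => by
    ext i
    simp only [Pi.add_apply, Matrix.mulVec_diagonal, Pi.sub_apply, Pi.one_apply]
    ring
  ext a
  constructor
  · rintro ⟨y, z, hyz, rfl⟩
    exact ⟨_, mem_shapeSet_iff_sub_mem_deviationSet.1 hyz, (hdiag z).symm⟩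
  · rintro ⟨q, hq, rfl⟩
    refine ⟨q.1, q.2 + 1, mem_shapeSet_iff_sub_mem_deviationSet.2 ?_, ?_⟩
    · simpa using hq
    · rw [hdiag, add_sub_cancel_right]

theorem convex_uncertaintySet : Convex ℝ (uncertaintySet N a0 τ δ A V) := by
  have h := (convex_deviationSet.linear_image
    ((Matrix.diagonal a0).mulVecLin ∘ₗ .snd ℝ (Fin m → ℝ) (Fin m → ℝ))).translate a0
      (s := _ '' deviationSet N τ δ A V)
  rw [Set.image_image] at h
  rw [uncertaintySet_eq_image]
  exact h

theorem isCompact_uncertaintySet (hZ : IsCompact (shapeSet N τ δ A V)) :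
    IsCompact (uncertaintySet N a0 τ δ A V) := by
  rw [uncertaintySet_eq_image]
  exact (isCompact_deviationSet_iff.2 hZ).image (by fun_prop)

theorem center_mem_uncertaintySet (hτ : 0 ≤ τ) (hδ : 0 ≤ δ) :
    a0 ∈ uncertaintySet N a0 τ δ A V := by
  rw [uncertaintySet_eq_image]
  exact ⟨0, zero_mem_deviationSet hτ hδ, by simp⟩

theorem nonneg_of_uncertaintySet_nonempty (hΩ : (uncertaintySet N a0 τ δ A V).Nonempty) :
    0 ≤ τ ∧ 0 ≤ δ := by
  obtain ⟨_, y, z, ⟨-, -, hA, hV⟩, -⟩ := hΩ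
  exact ⟨(apply_nonneg N _).trans hA, (apply_nonneg N _).trans hV⟩

theorem eq_zero_of_isCompact_shapeSet (hτ : 0 ≤ τ) (hδ : 0 ≤ δ)
    (hZ : IsCompact (shapeSet N τ δ A V)) {y : Fin m → ℝ} (hy : 0 ≤ y) (hAy : A *ᵥ y = 0) :
    y = 0 := by
  obtain ⟨C, hC⟩ := (isCompact_deviationSet_iff.2 hZ).isBounded.exists_norm_le
  have hray : ∀ k : ℕ, ((k : ℝ) • y, 0) ∈ deviationSet N τ δ A V := fun k => by
    refine ⟨?_, ?_, by simpa⟩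
    · simpa using add_mem_logEpigraph zero_mem_logEpigraph (d := ((k : ℝ) • y, 0)) le_rfl
        (smul_nonneg k.cast_nonneg hy)
    · rwa [Matrix.mulVec_smul, hAy, smul_zero, map_zero]
  by_contra hne
  obtain ⟨k, hk⟩ := exists_lt_nsmul (norm_pos_iff.2 hne) C
  have hle : ‖(k : ℝ) • y‖ ≤ C :=
    (norm_fst_le ((k : ℝ) • y, (0 : Fin m → ℝ))).trans (hC _ (hray k))
  rw [norm_smul, Real.norm_natCast, ← nsmul_eq_mul] at hle
  exact hk.not_ge hle

end UncertaintySet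

section Support

variable {m : ℕ} {N : Seminorm ℝ (Fin m → ℝ)} {a0 : Fin m → ℝ} {τ δ : ℝ}
  {A V : Matrix (Fin m) (Fin m) ℝ}

theorem le_neg_dotProduct_of_mem_dualFeasible (hN : ∀ y, N y = 0 → y = 0) (hτ : 0 ≤ τ)
    (hδ : 0 ≤ δ) {d : DualVars m} (hd : d ∈ dualFeasible a0 A V)
    {q : (Fin m → ℝ) × (Fin m → ℝ)} (hq : q ∈ deviationSet N τ δ A V) :
    ∑ k, (d.u k * Real.log (1 - d.w k / d.u k) + d.w k) - τ * dualNorm N d.s1 -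
      δ * dualNorm N d.s2 ≤ -((Matrix.diagonal a0 *ᵥ d.v) ⬝ᵥ q.2) := by
  obtain ⟨hu, hw, hu_pos, huw_pos⟩ := hd
  have hs1 : d.u ⬝ᵥ q.1 ≤ τ * dualNorm N d.s1 := by
    rw [← hu, Matrix.mulVec_transpose, ← Matrix.dotProduct_mulVec]
    exact (isGreatest_mul_dualNorm hN d.s1 hτ).2 ⟨_, hq.2.1, rfl⟩
  have hs2 : (Vᵀ *ᵥ d.s2) ⬝ᵥ q.2 ≤ δ * dualNorm N d.s2 := by
    rw [Matrix.mulVec_transpose, ← Matrix.dotProduct_mulVec]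
    exact (isGreatest_mul_dualNorm hN d.s2 hδ).2 ⟨_, hq.2.2, rfl⟩
  have hsum := (isLeast_image_logEpigraph hu_pos huw_pos).2 ⟨q, hq.1, rfl⟩
  rw [← hw, add_dotProduct]
  linarith

theorem exists_multipliers (hN : ∀ y, N y = 0 → y = 0) (hτ : 0 ≤ τ) (hδ : 0 ≤ δ)
    {s : Fin m → ℝ} (hs : ∀ i, 0 < (Aᵀ *ᵥ s) i) {p : Fin m → ℝ} {c : ℝ}
    (hc : ∀ q ∈ deviationSet N τ δ A V, c < -(p ⬝ᵥ q.2)) :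
    ∃ s1 s2, ∀ q ∈ logEpigraph (Fin m), c + τ * dualNorm N s1 + δ * dualNorm N s2 ≤
      (Aᵀ *ᵥ s1) ⬝ᵥ q.1 - (p - Vᵀ *ᵥ s2) ⬝ᵥ q.2 := by
  let cost : (Fin m → ℝ) × (Fin m → ℝ) →ₗ[ℝ] ℝ := -(dotProductEquiv ℝ (Fin m) p ∘ₗ .snd ℝ _ _)
  obtain ⟨ℓ, hℓ⟩ := exists_lagrange_multiplier (cost.convexOn convex_logEpigraph)
    (isClosed_image_epigraph_of_pos V hs cost.continuous_of_finiteDimensional)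
    ((convex_setOf_seminorm_le N τ).prod (convex_setOf_seminorm_le N δ))
    ((isCompact_setOf_seminorm_le hN τ).prod (isCompact_setOf_seminorm_le hN δ))
    ⟨0, zero_mem_logEpigraph, by simpa, by simpa⟩ (fun q hq hqB => hc q ⟨hq, hqB⟩)
  obtain ⟨s1, hs1⟩ := (dotProductEquiv ℝ (Fin m)).surjective (ℓ.toLinearMap ∘ₗ .inl ℝ _ _)
  obtain ⟨s2, hs2⟩ := (dotProductEquiv ℝ (Fin m)).surjective (ℓ.toLinearMap ∘ₗ .inr ℝ _ _)
  have hℓ_eq : ∀ b : (Fin m → ℝ) × (Fin m → ℝ), ℓ b = s1 ⬝ᵥ b.1 + s2 ⬝ᵥ b.2 := fun b => by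
    have h1 : s1 ⬝ᵥ b.1 = ℓ (b.1, 0) := DFunLike.congr_fun hs1 b.1
    have h2 : s2 ⬝ᵥ b.2 = ℓ (0, b.2) := DFunLike.congr_fun hs2 b.2
    rw [h1, h2, ← map_add, Prod.mk_add_mk, add_zero, zero_add]
  obtain ⟨b1, hb1, hsb1⟩ := (isGreatest_mul_dualNorm hN s1 hτ).1
  obtain ⟨b2, hb2, hsb2⟩ := (isGreatest_mul_dualNorm hN s2 hδ).1
  refine ⟨s1, s2, fun q hq => ?_⟩
  have hlt : ℓ (b1, b2) + c < ℓ (A *ᵥ q.1, V *ᵥ q.2) + -(p ⬝ᵥ q.2) :=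
    hℓ q hq (b1, b2) ⟨hb1, hb2⟩
  rw [hℓ_eq, hℓ_eq] at hlt
  rw [sub_dotProduct, Matrix.mulVec_transpose, Matrix.mulVec_transpose,
    ← Matrix.dotProduct_mulVec, ← Matrix.dotProduct_mulVec]
  dsimp only at hsb1 hsb2 hlt
  linarith

theorem exists_mem_dualFeasible_le (hN : ∀ y, N y = 0 → y = 0) (hτ : 0 ≤ τ) (hδ : 0 ≤ δ)
    (hZ : IsCompact (shapeSet N τ δ A V)) {v : Fin m → ℝ} {c c' : ℝ} (hcc' : c < c')
    (hc' : ∀ q ∈ deviationSet N τ δ A V, c' < -((Matrix.diagonal a0 *ᵥ v) ⬝ᵥ q.2)) :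
    ∃ d ∈ dualFeasible a0 A V, d.v = v ∧
      c ≤ ∑ k, (d.u k * Real.log (1 - d.w k / d.u k) + d.w k) - τ * dualNorm N d.s1 -
        δ * dualNorm N d.s2 := by
  obtain ⟨s, hs⟩ := exists_transpose_mulVec_pos
    fun y hy hAy => eq_zero_of_isCompact_shapeSet hτ hδ hZ hy hAy
  obtain ⟨s1, s2, hbound⟩ := exists_multipliers hN hτ hδ hs hc'
  obtain ⟨ε, hε, hε_lt⟩ := exists_pos_mul_lt (sub_pos.2 hcc') (τ * dualNorm N s)
  set w := Matrix.diagonal a0 *ᵥ v - Vᵀ *ᵥ s2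
  -- The multipliers only give `0 ≤ u` and `0 ≤ u - w`; moving `s1` along `s` makes both strict.
  set u := Aᵀ *ᵥ (s1 + ε • s) with hu
  have hu_lt : ∀ k, (Aᵀ *ᵥ s1) k < u k := fun k => by
    rw [hu, Matrix.mulVec_add, Matrix.mulVec_smul]
    exact lt_add_of_pos_right _ (mul_pos hε (hs k))
  have hsign := nonneg_and_le_of_forall_mem_logEpigraph_le hbound
  have hu_pos : ∀ k, 0 < u k := fun k => (hsign k).1.trans_lt (hu_lt k)
  have huw_pos : ∀ k, 0 < u k - w k := fun k => sub_pos.2 ((hsign k).2.trans_lt (hu_lt k))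
  refine ⟨⟨u, v, w, s1 + ε • s, s2⟩, ⟨rfl, sub_add_cancel _ _, hu_pos, huw_pos⟩, rfl, ?_⟩
  obtain ⟨q, hq, hq_eq⟩ := (isLeast_image_logEpigraph hu_pos huw_pos).1
  have hu_le : (Aᵀ *ᵥ s1) ⬝ᵥ q.1 ≤ u ⬝ᵥ q.1 :=
    dotProduct_le_dotProduct_of_nonneg_right (fun k => (hu_lt k).le)
      (fst_nonneg_of_mem_logEpigraph hq)
  have hnorm := mul_le_mul_of_nonneg_left (dualNorm_add_smul_le hN s1 s hε.le) hτ
  have hbound_q := hbound q hq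
  dsimp only at hq_eq ⊢
  linarith

end Support

theorem IsConvexFun.convexOn_toReal {m : ℕ} {g : (Fin m → ℝ) → EReal} (hg : IsConvexFun g)
    (hg_bot : ∀ a, g a ≠ ⊥) : ConvexOn ℝ (effDom g) fun a => (g a).toReal := by
  have hcombo : ∀ a ∈ effDom g, ∀ b ∈ effDom g, ∀ s t : ℝ, 0 ≤ s → 0 ≤ t → s + t = 1 →
      g (s • a + t • b) ≤ ((s • (g a).toReal + t • (g b).toReal : ℝ) : EReal) :=
    fun a ha b hb s t hs ht hst =>
      hg (x := (a, (g a).toReal)) (EReal.coe_toReal ha.ne (hg_bot a)).ge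
        (y := (b, (g b).toReal)) (EReal.coe_toReal hb.ne (hg_bot b)).ge hs ht hst
  exact ⟨fun a ha b hb s t hs ht hst =>
      (hcombo a ha b hb s t hs ht hst).trans_lt (EReal.coe_lt_top _),
    fun a ha b hb s t hs ht hst =>
      EReal.toReal_le_toReal (hcombo a ha b hb s t hs ht hst) (hg_bot _) (EReal.coe_ne_top _)⟩

theorem IsConvexFun.exists_eq_biInf {m : ℕ} {g : (Fin m → ℝ) → EReal} (hg : IsConvexFun g)
    (hg_bot : ∀ a, g a ≠ ⊥) (hg_top : ∀ a, g a ≠ ⊤) {Ω : Set (Fin m → ℝ)} (hΩ : IsCompact Ω)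
    (hΩ_ne : Ω.Nonempty) : ∃ a ∈ Ω, g a = ⨅ b ∈ Ω, g b := by
  have hdom : effDom g = Set.univ := Set.eq_univ_of_forall fun a => lt_top_iff_ne_top.2 (hg_top a)
  have hconv : ConvexOn ℝ Set.univ fun a => (g a).toReal := hdom ▸ hg.convexOn_toReal hg_bot
  obtain ⟨a, ha, hmin⟩ :=
    hΩ.exists_isMinOn hΩ_ne hconv.locallyLipschitz.continuous.continuousOn
  refine ⟨a, ha, le_antisymm (le_iInf₂ fun b hb => ?_) (biInf_le g ha)⟩
  rw [← EReal.coe_toReal (hg_top a) (hg_bot a), ← EReal.coe_toReal (hg_top b) (hg_bot b)]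
  exact EReal.coe_le_coe_iff.2 (hmin hb)

theorem coe_dotProduct_sub_le_conjugate {m : ℕ} {g : (Fin m → ℝ) → EReal} {a : Fin m → ℝ}
    (ha : a ∈ effDom g) (v : Fin m → ℝ) : ((v ⬝ᵥ a : ℝ) : EReal) - g a ≤ conjugate g v :=
  le_biSup (fun a => ((v ⬝ᵥ a : ℝ) : EReal) - g a) ha

theorem conjugate_le_of_forall_le_toReal {m : ℕ} {g : (Fin m → ℝ) → EReal}
    (hg_bot : ∀ a, g a ≠ ⊥) {v : Fin m → ℝ} {κ : ℝ}
    (h : ∀ a ∈ effDom g, v ⬝ᵥ a - (g a).toReal ≤ κ) : conjugate g v ≤ κ :=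
  iSup₂_le fun a ha => by
    rw [← EReal.coe_toReal ha.ne (hg_bot a), ← EReal.coe_sub]
    exact EReal.coe_le_coe_iff.2 (h a ha)

/-- The dual objective at a fixed decision `x`, which enters only through `g = f₀(·, x)`. -/
noncomputable def dualValue {m : ℕ} (g : (Fin m → ℝ) → EReal) (N : Seminorm ℝ (Fin m → ℝ))
    (a0 : Fin m → ℝ) (τ δ : ℝ) (d : DualVars m) : EReal :=
  ((-(a0 ⬝ᵥ d.v) + ∑ k, (d.u k * Real.log (1 - d.w k / d.u k) + d.w k)
      - τ * dualNorm N d.s1 - δ * dualNorm N d.s2 : ℝ) : EReal) - conjugate g (-d.v)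

section Duality

variable {m : ℕ} {g : (Fin m → ℝ) → EReal} {N : Seminorm ℝ (Fin m → ℝ)} {a0 : Fin m → ℝ}
  {τ δ : ℝ} {A V : Matrix (Fin m) (Fin m) ℝ}

theorem neg_dotProduct_center_add (v h : Fin m → ℝ) :
    -v ⬝ᵥ (a0 + Matrix.diagonal a0 *ᵥ h) =
      -(a0 ⬝ᵥ v) + -((Matrix.diagonal a0 *ᵥ v) ⬝ᵥ h) := by
  rw [neg_dotProduct, dotProduct_add, neg_add, dotProduct_comm v a0, Matrix.dotProduct_mulVec,
    ← Matrix.mulVec_transpose, Matrix.diagonal_transpose]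

theorem dualValue_le_of_mem (hg_bot : ∀ a, g a ≠ ⊥) (hN : ∀ y, N y = 0 → y = 0)
    {d : DualVars m} (hd : d ∈ dualFeasible a0 A V) {a : Fin m → ℝ}
    (ha : a ∈ uncertaintySet N a0 τ δ A V) : dualValue g N a0 τ δ d ≤ g a := by
  obtain ⟨hτ, hδ⟩ := nonneg_of_uncertaintySet_nonempty ⟨a, ha⟩
  rcases eq_or_ne (g a) ⊤ with htop | htop
  · exact htop ▸ le_top
  refine (EReal.sub_le_sub le_rfl
    (coe_dotProduct_sub_le_conjugate htop.lt_top (-d.v))).trans ?_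
  rw [uncertaintySet_eq_image] at ha
  obtain ⟨q, hq, rfl⟩ := ha
  have hbound := le_neg_dotProduct_of_mem_dualFeasible hN hτ hδ hd hq
  rw [← EReal.coe_toReal htop (hg_bot _), ← EReal.coe_sub, ← EReal.coe_sub,
    EReal.coe_le_coe_iff, neg_dotProduct_center_add]
  linarith

theorem exists_mem_dualFeasible_le_dualValue (hg_bot : ∀ a, g a ≠ ⊥) (hg : IsConvexFun g)
    (hN : ∀ y, N y = 0 → y = 0)
    (hri : (uncertaintySet N a0 τ δ A V ∩ intrinsicInterior ℝ (effDom g)).Nonempty)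
    (hZ : IsCompact (shapeSet N τ δ A V)) {c : ℝ}
    (hc : (c : EReal) < ⨅ a ∈ uncertaintySet N a0 τ δ A V, g a) :
    ∃ d ∈ dualFeasible a0 A V, (c : EReal) ≤ dualValue g N a0 τ δ d := by
  obtain ⟨x₀, hx₀Ω, hx₀⟩ := hri
  obtain ⟨hτ, hδ⟩ := nonneg_of_uncertaintySet_nonempty ⟨x₀, hx₀Ω⟩
  obtain ⟨c₂, hc₂, hc₂_lt⟩ := EReal.lt_iff_exists_real_btwn.1 hc
  obtain ⟨c₁, hc₁, hc₁₂⟩ := exists_between (EReal.coe_lt_coe_iff.1 hc₂)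
  have hΩ : ∀ a ∈ uncertaintySet N a0 τ δ A V, a ∈ effDom g → c₂ ≤ (g a).toReal :=
    fun a ha hdom => EReal.coe_le_coe_iff.1 <| by
      rw [EReal.coe_toReal hdom.ne (hg_bot a)]
      exact hc₂_lt.le.trans (biInf_le g ha)
  obtain ⟨ℓ, κ, hℓΩ, hℓg⟩ := exists_affine_minorant (hg.convexOn_toReal hg_bot)
    convex_uncertaintySet (isCompact_uncertaintySet hZ) hx₀ hx₀Ω hc₁₂ hΩ
  obtain ⟨v, hv⟩ := (dotProductEquiv ℝ (Fin m)).surjective ℓ.toLinearMap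
  have hv_apply : ∀ a, v ⬝ᵥ a = ℓ a := DFunLike.congr_fun hv
  have hconj : conjugate g (-v) ≤ ((-κ : ℝ) : EReal) :=
    conjugate_le_of_forall_le_toReal hg_bot fun a ha => by
      rw [neg_dotProduct, hv_apply]
      linarith [hℓg a ha]
  have hsupport : ∀ q ∈ deviationSet N τ δ A V,
      c₁ - κ + a0 ⬝ᵥ v < -((Matrix.diagonal a0 *ᵥ v) ⬝ᵥ q.2) := fun q hq => by
    have hlt := hℓΩ _ (uncertaintySet_eq_image.ge ⟨q, hq, rfl⟩)
    have hpair := neg_dotProduct_center_add (a0 := a0) v q.2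
    rw [neg_dotProduct, hv_apply] at hpair
    linarith
  obtain ⟨d, hd, rfl, hle⟩ := exists_mem_dualFeasible_le hN hτ hδ hZ
    (show c - κ + a0 ⬝ᵥ v < c₁ - κ + a0 ⬝ᵥ v by linarith) hsupport
  refine ⟨d, hd, le_trans ?_ (EReal.sub_le_sub le_rfl hconj)⟩
  rw [← EReal.coe_sub, EReal.coe_le_coe_iff]
  linarith

theorem biInf_uncertaintySet_eq_biSup_dualValue (hg_bot : ∀ a, g a ≠ ⊥) (hg : IsConvexFun g)
    (hN : ∀ y, N y = 0 → y = 0)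
    (hri : (uncertaintySet N a0 τ δ A V ∩ intrinsicInterior ℝ (effDom g)).Nonempty)
    (hZ : IsCompact (shapeSet N τ δ A V)) :
    ⨅ a ∈ uncertaintySet N a0 τ δ A V, g a =
      ⨆ d ∈ dualFeasible a0 A V, dualValue g N a0 τ δ d := by
  refine le_antisymm (EReal.ge_of_forall_gt_iff_ge.1 fun c hc => ?_)
    (iSup₂_le fun d hd => le_iInf₂ fun a ha => dualValue_le_of_mem hg_bot hN hd ha)
  obtain ⟨d, hd, hle⟩ := exists_mem_dualFeasible_le_dualValue hg_bot hg hN hri hZ hc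
  exact hle.trans (le_biSup (dualValue g N a0 τ δ) hd)

end Duality

section Optimal

variable {α β : Type*}

theorem isOptimal_iff_eq_biSup {F : α → EReal} {C : Set α} {p : α} :
    IsOptimal F C p ↔ p ∈ C ∧ F p = ⨆ q ∈ C, F q :=
  and_congr_right fun hp => ⟨fun h => le_antisymm (le_biSup F hp) (iSup₂_le h),
    fun h _ hq => (le_biSup F hq).trans h.ge⟩

theorem isOptimal_prod_iff {Φ : α → EReal} {Ψ : α → β → EReal} {S : Set α} {D : Set β}
    (h : ∀ x, Φ x = ⨆ d ∈ D, Ψ x d) {x : α} {d : β} :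
    IsOptimal (fun p : α × β => Ψ p.1 p.2) (S ×ˢ D) (x, d) ↔
      IsOptimal Φ S x ∧ d ∈ D ∧ Ψ x d = Φ x := by
  have hle : ∀ x, ∀ d ∈ D, Ψ x d ≤ Φ x := fun x d hd => (le_biSup (Ψ x) hd).trans (h x).ge
  constructor
  · rintro ⟨⟨hx, hd⟩, hopt⟩
    have hub : ∀ x' ∈ S, Φ x' ≤ Ψ x d := fun x' hx' =>
      (h x').le.trans (iSup₂_le fun d' hd' => hopt (x', d') ⟨hx', hd'⟩)
    exact ⟨⟨hx, fun x' hx' => (hub x' hx').trans (hle x d hd)⟩, hd,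
      (hle x d hd).antisymm (hub x hx)⟩
  · rintro ⟨⟨hx, hopt⟩, hd, heq⟩
    exact ⟨⟨hx, hd⟩, fun p hp => (hle p.1 p.2 hp.2).trans ((hopt p.1 hp.1).trans heq.ge)⟩

end Optimal

end RobustPos

theorem mainTheorem6_general {m : ℕ} {X : Type*} (f : X → (Fin m → ℝ) → EReal)
    (hf_bot : ∀ x a, f x a ≠ ⊥) (hf_convex : ∀ x, IsConvexFun (f x))
    (N : Seminorm ℝ (Fin m → ℝ)) (hN : ∀ y, N y = 0 → y = 0) (a0 : Fin m → ℝ) (τ δ : ℝ)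
    (A V : Matrix (Fin m) (Fin m) ℝ)
    (hri : ∀ x, (uncertaintySet N a0 τ δ A V ∩ intrinsicInterior ℝ (effDom (f x))).Nonempty)
    (hZ : IsCompact (shapeSet N τ δ A V)) (S : Set X) :
    (∀ x, ⨅ a ∈ uncertaintySet N a0 τ δ A V, f x a =
      ⨆ d ∈ dualFeasible a0 A V, dualValue (f x) N a0 τ δ d) ∧
    (⨆ x ∈ S, ⨅ a ∈ uncertaintySet N a0 τ δ A V, f x a) =
      (⨆ p ∈ S ×ˢ dualFeasible a0 A V, dualValue (f p.1) N a0 τ δ p.2) ∧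
    (∀ x, IsOptimal (fun x => ⨅ a ∈ uncertaintySet N a0 τ δ A V, f x a) S x ↔
      x ∈ S ∧ (⨆ d ∈ dualFeasible a0 A V, dualValue (f x) N a0 τ δ d) =
        ⨆ p ∈ S ×ˢ dualFeasible a0 A V, dualValue (f p.1) N a0 τ δ p.2) ∧
    (∀ x d, IsOptimal (fun p : X × DualVars m => dualValue (f p.1) N a0 τ δ p.2)
        (S ×ˢ dualFeasible a0 A V) (x, d) ↔
      IsOptimal (fun x => ⨅ a ∈ uncertaintySet N a0 τ δ A V, f x a) S x ∧
        d ∈ dualFeasible a0 A V ∧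
        dualValue (f x) N a0 τ δ d = ⨅ a ∈ uncertaintySet N a0 τ δ A V, f x a) ∧
    (∀ x, (∀ a, f x a ≠ ⊤) → ∃ a ∈ uncertaintySet N a0 τ δ A V,
      f x a = ⨅ b ∈ uncertaintySet N a0 τ δ A V, f x b) := by
  have hdual : ∀ x, ⨅ a ∈ uncertaintySet N a0 τ δ A V, f x a =
      ⨆ d ∈ dualFeasible a0 A V, dualValue (f x) N a0 τ δ d := fun x =>
    biInf_uncertaintySet_eq_biSup_dualValue (hf_bot x) (hf_convex x) hN (hri x) hZ
  have hvalue : (⨆ x ∈ S, ⨅ a ∈ uncertaintySet N a0 τ δ A V, f x a) =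
      ⨆ p ∈ S ×ˢ dualFeasible a0 A V, dualValue (f p.1) N a0 τ δ p.2 := by
    simp only [hdual]
    exact (biSup_prod (f := fun p : X × DualVars m => dualValue (f p.1) N a0 τ δ p.2)).symm
  refine ⟨hdual, hvalue, fun x => ?_, fun x d => isOptimal_prod_iff hdual, fun x hx_top => ?_⟩
  · rw [isOptimal_iff_eq_biSup, hvalue, hdual]
  · exact (hf_convex x).exists_eq_biInf (hf_bot x) hx_top (isCompact_uncertaintySet hZ)
      (hri x).left

theorem mainTheorem6 {m n : ℕ}
    (f0 : (Fin m → ℝ) → (Fin n → ℝ) → EReal) (hf_bot : ∀ a x, f0 a x ≠ ⊥)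
    (hf_convex : ∀ x, IsConvexFun (fun a => f0 a x))
    (N : Seminorm ℝ (Fin m → ℝ)) (hN : ∀ y, N y = 0 → y = 0)
    (a0 : Fin m → ℝ) (ha0 : ∀ i, 0 < a0 i)
    (hri : ∀ x, a0 ∈ intrinsicInterior ℝ (effDom (fun a => f0 a x)))
    (τ δ : ℝ) (hτ : 0 ≤ τ) (hδ : 0 ≤ δ) (A V : Matrix (Fin m) (Fin m) ℝ)
    (hZ : IsCompact (shapeSet N τ δ A V))
    (S : Set (Fin n → ℝ)) :
    -- for every `x`, the inner infimum equals the supremum over the auxiliary variables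
    (∀ x, worstCase f0 (uncertaintySet N a0 τ δ A V) x =
      ⨆ d ∈ dualFeasible a0 A V, dualObjective f0 N a0 τ δ x d) ∧
    -- the two problems have the same optimal value
    (⨆ x ∈ S, worstCase f0 (uncertaintySet N a0 τ δ A V) x) =
      (⨆ p ∈ S ×ˢ dualFeasible a0 A V, dualObjective f0 N a0 τ δ p.1 p.2) ∧
    -- optimal solutions of the robust problem, read off from the dual problem
    (∀ x, IsOptimal (worstCase f0 (uncertaintySet N a0 τ δ A V)) S x ↔
      x ∈ S ∧ (⨆ d ∈ dualFeasible a0 A V, dualObjective f0 N a0 τ δ x d) =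
        ⨆ p ∈ S ×ˢ dualFeasible a0 A V, dualObjective f0 N a0 τ δ p.1 p.2) ∧
    -- optimal solutions of the dual problem, read off from the robust problem
    (∀ x d, IsOptimal (fun p => dualObjective f0 N a0 τ δ p.1 p.2)
        (S ×ˢ dualFeasible a0 A V) (x, d) ↔
      IsOptimal (worstCase f0 (uncertaintySet N a0 τ δ A V)) S x ∧ d ∈ dualFeasible a0 A V ∧
        dualObjective f0 N a0 τ δ x d = worstCase f0 (uncertaintySet N a0 τ δ A V) x) ∧
    -- the inner infimum is a minimum wherever `f0 (·, x)` is finite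
    (∀ x, (∀ a, f0 a x ≠ ⊤) → ∃ a ∈ uncertaintySet N a0 τ δ A V,
      f0 a x = worstCase f0 (uncertaintySet N a0 τ δ A V) x) :=
  mainTheorem6_general (fun x a => f0 a x) (fun x a => hf_bot a x) hf_convex N hN a0 τ δ A V
    (fun x => ⟨a0, center_mem_uncertaintySet hτ hδ, hri x⟩) hZ S
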